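/- Let $K\ge 3$ be an integer and let $\theta,p>0$ be real numbers. For $N\ge 2$ let $\mathcal E_{K,N}=\{\eta:\mathbb Z/K\mathbb Z\to\mathbb N:\ \sum_{k}\eta(k)=N\}$ and consider the continuous-time Markov chain on $\mathcal E_{K,N}$ (the Fleming–Viot system of $N$ particles on the cycle $\mathbb Z/K\mathbb Z$ with uniform killing) whose generator acts on functions $f:\mathcal E_{K,N}\to\mathbb R$ by $$\mathcal L_{K,N}f(\eta)=\sum_{i,j\in\mathbb Z/K\mathbb Z}\eta(i)\,\bigl[f(\eta-e_i+e_j)-f(\eta)\bigr]\Bigl(\mathbf 1_{\{j=i+1\}}+\theta\,\mathbf 1_{\{j=i-1\}}+p\,\frac{\eta(j)}{N-1}\Bigr),$$ where $e_i$ denotes the configuration with a single particle, at site $i$ (terms with $\eta(i)=0$ vanish). This chain has a unique stationary distribution $\nu_N$, that is, a unique probability measure on $\mathcal E_{K,N}$ with $\int\mathcal L_{K,N}f\,d\nu_N=0$ for all $f$. For every fixed $k\in\{0,1,\dots,K-1\}$ (identified with an element of $\mathbb Z/K\mathbb Z$), as $N\to\infty$, $$\operatorname{Cov}_{\nu_N}\Bigl[\frac{\eta(0)}N,\frac{\eta(k)}N\Bigr]=\frac1N\left(\frac1K\mathbf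 1_{\{k=0\}}-\frac1{K^2}+\frac{p\,\bigl(6k(k-K)+K^2-1\bigr)}{6K^2(1+\theta)}\right)+\frac1{N^2}\,\frac{p^2\bigl(30k(K-k)[k(K-k)+2]-(K-1)(K+1)(K^2+11)\bigr)}{180K^2(1+\theta)^2}+o\!\left(\frac1{N^2}\right).$$ -/

import Mathlib

open scoped ProbabilityTheory

/-- Configurations of `N` indistinguishable particles on the cycle `ℤ/Kℤ`:
`η k` is the number of particles at the site `k`. -/
abbrev Config (K N : ℕ) [NeZero K] : Type :=
  {η : ZMod K → ℕ // ∑ k, η k = N}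

/-- The configuration `η - e_i + e_j`, in which one particle of `η` has moved from `i` to `j`.
It is meant for `η i > 0` only; if the site `i` is empty nothing moves. -/
def Config.move {K N : ℕ} [NeZero K] (η : Config K N) (i j : ZMod K) : Config K N :=
  if h : 0 < η.1 i then
    ⟨fun l => η.1 l - (if l = i then 1 else 0) + (if l = j then 1 else 0), by
      have hle : ∀ l ∈ Finset.univ, (if l = i then 1 else 0) ≤ η.1 l := by
        intro l _
        split_ifs with hl
        · subst hl
          exact h
        · exact Nat.zero_le _
      have hpos : 0 < ∑ l, η.1 l :=
        lt_of_lt_of_le h (Finset.single_le_sum (fun l _ => Nat.zero_le (η.1 l))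
          (Finset.mem_univ i))
      have hη := η.2
      rw [Finset.sum_add_distrib, Finset.sum_tsub_distrib _ hle]
      simp
      omega⟩
  else η

/-- The rate at which each particle sitting at `i` jumps to `j` in the configuration `η`:
rate `1` clockwise, rate `θ` anticlockwise, and at rate `p` the particle is killed and reborn at
the position of one of the `N - 1` other particles, uniformly chosen. -/
noncomputable def jumpRate {K N : ℕ} [NeZero K] (θ p : ℝ) (η : Config K N) (i j : ZMod K) : ℝ :=
  (if j = i + 1 then 1 else 0) + θ * (if j = i - 1 then 1 else 0)
    + p * ((η.1 j : ℝ) / ((N : ℝ) - 1))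

/-- The infinitesimal generator of the `N`-particle process. -/
noncomputable def generator {K N : ℕ} [NeZero K] (θ p : ℝ) (f : Config K N → ℝ)
    (η : Config K N) : ℝ :=
  ∑ i : ZMod K, ∑ j : ZMod K, (η.1 i : ℝ) * (f (η.move i j) - f η) * jumpRate θ p η i j

/-- `ν` is a stationary distribution of the `N`-particle process: a probability measure on the
finite set of configurations such that `ν (L f) = 0` for every function `f`. -/
structure IsStationaryDistribution {K N : ℕ} [NeZero K] (θ p : ℝ)
    (ν : MeasureTheory.Measure (Config K N)) : Prop where
  isProbabilityMeasure : MeasureTheory.IsProbabilityMeasure ν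
  integral_generator : ∀ f : Config K N → ℝ, ∫ η, generator θ p f η ∂ν = 0

/-- The coefficient of `1 / N` in the expansion, at the site `k ∈ {0, …, K - 1}`. -/
noncomputable def firstCoeff (K : ℕ) (θ p : ℝ) (k : ℕ) : ℝ :=
  1 / (K : ℝ) * (if k = 0 then 1 else 0) - 1 / (K : ℝ) ^ 2
    + p * (6 * (k : ℝ) * ((k : ℝ) - K) + (K : ℝ) ^ 2 - 1) / (6 * (K : ℝ) ^ 2 * (θ + 1))

/-- The coefficient of `1 / N ^ 2` in the expansion, at the site `k ∈ {0, …, K - 1}`. -/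
noncomputable def secondCoeff (K : ℕ) (θ p : ℝ) (k : ℕ) : ℝ :=
  p ^ 2 * (30 * (k : ℝ) * ((K : ℝ) - k) * ((k : ℝ) * ((K : ℝ) - k) + 2)
      - ((K : ℝ) - 1) * ((K : ℝ) + 1) * ((K : ℝ) ^ 2 + 11))
    / (180 * (K : ℝ) ^ 2 * (θ + 1) ^ 2)

/-! Existence and uniqueness of the stationary law come from the maximum principle: `f = L g +
const` is always solvable, so every stationary integral is determined.

For the covariances, the killing terms cancel in `L` applied to a coordinate, and their cubic parts
cancel in `L` applied to a product of two, so the moment equations close at order two. The means are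
all `N / K`, and second moments are rotation invariant; hence `s k = E[η(0) η(k)]` solves a discrete
Poisson equation on the cycle with diffusivity `1 + θ`, killing `2p / (N - 1)` and an explicit
source (`correlation_balance`).

The two coefficients solve the equations of orders `1/N` and `1/N²` (`firstCoeff_laplacian`,
`secondCoeff_laplacian`) and have zero sum. The error of the two-term expansion therefore has zero
sum and solves the same equation with residual `O(1/N³)`. An energy estimate uniform in the killing
rate (`abs_le_of_laplacian_sub`) makes the error itself `O(1/N³)`. -/

/-- A linear operator on a finite function space that satisfies the maximum principle and kills
only constants has a complement spanned by the constant functions; the projection onto the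
constants is a positive functional. -/
theorem exists_positive_functional_of_max_principle {X : Type*} [Finite X] [Nonempty X]
    (G : (X → ℝ) →ₗ[ℝ] (X → ℝ))
    (hmax : ∀ g x, (∀ y, g y ≤ g x) → G g x ≤ 0)
    (hker : ∀ g, G g = 0 → ∀ x y, g x = g y) :
    ∃ μ : (X → ℝ) →ₗ[ℝ] ℝ, (∀ f, (∀ x, 0 ≤ f x) → 0 ≤ μ f) ∧ (∀ f, μ (G f) = 0) ∧ μ 1 = 1 ∧
      ∀ f, ∃ g, f = G g + fun _ => μ f := by
  obtain ⟨x₀⟩ := ‹Nonempty X›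
  have hmin : ∀ g x, (∀ y, g x ≤ g y) → 0 ≤ G g x := by
    intro g x hx
    have := hmax (-g) x (fun y => by simpa using hx y)
    simpa using this
  have hconst : ∀ c : ℝ, G (fun _ => c) = 0 := by
    intro c
    funext x
    exact le_antisymm (hmax _ x fun _ => le_rfl) (hmin _ x fun _ => le_rfl)
  -- Adding evaluation at a base point makes `G` invertible; the functional sought is `f ↦ (Ψ⁻¹ f)
  -- x₀`.
  let Ψ : (X → ℝ) →ₗ[ℝ] (X → ℝ) :=
    G + LinearMap.pi fun _ => LinearMap.proj x₀
  have hΨ : ∀ g, Ψ g = G g + fun _ => g x₀ := fun g => rfl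
  have hinj : Function.Injective Ψ := by
    rw [← LinearMap.ker_eq_bot, LinearMap.ker_eq_bot']
    intro g hg
    rw [hΨ] at hg
    have hx : ∀ x, G g x + g x₀ = 0 := fun x => congrFun hg x
    obtain ⟨a, ha⟩ := Finite.exists_max g
    obtain ⟨b, hb⟩ := Finite.exists_min g
    -- `G g` is the constant `-g x₀`, nonpositive at a maximum of `g` and nonnegative at a minimum.
    have h0 : g x₀ = 0 := by
      have h1 := hmax g a ha
      have h2 := hmin g b hb
      have h3 := hx a
      have h4 := hx b
      linarith
    have hG : G g = 0 := by
      funext x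
      have := hx x
      simp only [Pi.zero_apply]
      linarith
    funext x
    rw [hker g hG x x₀, h0]
    rfl
  let e := LinearEquiv.ofInjectiveEndo Ψ hinj
  have he : ∀ g, e g = G g + fun _ => g x₀ := fun g => hΨ g
  have hdec : ∀ f, f = G (e.symm f) + fun _ => e.symm f x₀ := by
    intro f
    rw [← he, LinearEquiv.apply_symm_apply]
  refine ⟨(LinearMap.proj x₀).comp e.symm.toLinearMap, ?_, ?_, ?_, fun f => ⟨e.symm f, hdec f⟩⟩
  · intro f hf
    obtain ⟨a, ha⟩ := Finite.exists_max (e.symm f)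
    have h1 := hmax _ a ha
    have h2 := congrFun (hdec f) a
    have h3 := hf a
    simp only [Pi.add_apply] at h2
    change 0 ≤ e.symm f x₀
    linarith
  · intro f
    have : e.symm (G f) = f - fun _ => f x₀ := by
      rw [LinearEquiv.symm_apply_eq, he, map_sub, hconst]
      funext x
      simp
    simp [this]
  · have : e.symm (1 : X → ℝ) = 1 := by
      rw [LinearEquiv.symm_apply_eq, he]
      have := hconst 1
      change (1 : X → ℝ) = G (fun _ => 1) + fun _ => 1
      rw [this]
      funext x
      simp
    simp [this]

theorem ZMod.val_add_one_cases {K : ℕ} [NeZero K] (k : ZMod K) :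
    (k + 1).val = k.val + 1 ∨ k.val + 1 = K ∧ (k + 1).val = 0 := by
  have hlt := ZMod.val_lt k
  have hadd := ZMod.val_add k 1
  rw [ZMod.val_one_eq_one_mod, Nat.add_mod_mod] at hadd
  rcases Nat.lt_or_ge (k.val + 1) K with h | h
  · exact Or.inl (hadd.trans (Nat.mod_eq_of_lt h))
  · have hK : k.val + 1 = K := le_antisymm hlt h
    exact Or.inr ⟨hK, by rw [hadd, hK, Nat.mod_self]⟩

/-! ### Configurations and their accessibility by clockwise moves -/

namespace Config

variable {K N : ℕ} [NeZero K]

theorem le_total (η : Config K N) (i : ZMod K) : η.1 i ≤ N :=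
  (Finset.single_le_sum (fun l _ => Nat.zero_le (η.1 l)) (Finset.mem_univ i)).trans η.2.le

instance : Finite (Config K N) :=
  Finite.of_injective
    (fun (η : Config K N) (i : ZMod K) => (⟨η.1 i, Nat.lt_succ_of_le (η.le_total i)⟩ : Fin (N + 1)))
    fun _ _ h => Subtype.ext <| funext fun i => congrArg Fin.val (congrFun h i)

instance : Nonempty (Config K N) := ⟨⟨Pi.single 0 N, by simp⟩⟩

theorem sum_coe (η : Config K N) : ∑ k, (η.1 k : ℝ) = N := by
  exact_mod_cast η.2

theorem move_apply {η : Config K N} {i : ZMod K} (h : 0 < η.1 i) (j a : ZMod K) :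
    ((η.move i j).1 a : ℝ) =
      (η.1 a : ℝ) + ((if j = a then 1 else 0) - (if i = a then 1 else 0)) := by
  have hle : (if a = i then 1 else 0) ≤ η.1 a := by
    split_ifs with ha
    · subst ha
      exact h
    · exact Nat.zero_le _
  simp only [move, dif_pos h]
  push_cast [Nat.cast_sub hle]
  simp only [eq_comm (a := a)]
  ring

/-- The total clockwise distance of the particles to the site `0`. -/
def distance (η : Config K N) : ℕ := ∑ i, η.1 i * (-i).val

/-- A particle away from `0` comes one step closer without wrapping around. The comparison is made
in `ℝ` to avoid truncated subtraction. -/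
theorem distance_move_lt {η : Config K N} {i : ZMod K} (h : 0 < η.1 i) (hi : i ≠ 0) :
    (η.move i (i + 1)).distance < η.distance := by
  have hval : ((-(i + 1)).val : ℝ) + 1 = (-i).val := by
    have hsucc := ZMod.val_add_one_cases (-(i + 1))
    rw [show -(i + 1) + 1 = -i by ring] at hsucc
    rcases hsucc with h1 | ⟨-, h1⟩
    · exact_mod_cast h1.symm
    · exact absurd ((ZMod.val_eq_zero _).mp h1) (neg_ne_zero.mpr hi)
  have : ((η.move i (i + 1)).distance : ℝ) < η.distance := by
    simp only [distance]
    push_cast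
    simp only [move_apply h, add_mul, sub_mul, Finset.sum_add_distrib, Finset.sum_sub_distrib,
      ite_mul, zero_mul, one_mul, Finset.sum_ite_eq, Finset.mem_univ, if_true]
    linarith
  exact_mod_cast this

theorem eq_of_forall_eq_zero {η : Config K N} (h : ∀ i, i ≠ 0 → η.1 i = 0) :
    η.1 = Pi.single 0 N := by
  funext i
  by_cases hi : i = 0
  · subst hi
    rw [Pi.single_eq_same]
    exact (Finset.sum_eq_single 0 (fun j _ hj => h j hj) (by simp)).symm.trans η.2
  · rw [Pi.single_eq_of_ne hi, h i hi]

/-- Moving particles clockwise, every configuration can be driven to the one in which all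
particles sit at `0`. -/
theorem exists_mem_of_closed {s : Set (Config K N)} (hs : s.Nonempty)
    (hclosed : ∀ η ∈ s, ∀ i, 0 < η.1 i → η.move i (i + 1) ∈ s) :
    ∃ η ∈ s, η.1 = Pi.single 0 N := by
  obtain ⟨η, hη, hmin⟩ := Set.exists_min_image s distance s.toFinite hs
  refine ⟨η, hη, eq_of_forall_eq_zero fun i hi => ?_⟩
  by_contra hne
  have hpos := Nat.pos_of_ne_zero hne
  exact absurd (hmin _ (hclosed η hη i hpos)) (not_le.mpr (distance_move_lt hpos hi))

end Config

/-! ### Maximum principle for the generator; the stationary law -/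

section Generator

variable {K N : ℕ} [NeZero K] {θ p : ℝ}

theorem jumpRate_nonneg (hN : 2 ≤ N) (hθ : 0 < θ) (hp : 0 < p) (η : Config K N) (i j : ZMod K) :
    0 ≤ jumpRate θ p η i j := by
  have : (0 : ℝ) ≤ (N : ℝ) - 1 := by
    have : (2 : ℝ) ≤ N := by exact_mod_cast hN
    linarith
  unfold jumpRate
  positivity

theorem jumpRate_succ_pos (hN : 2 ≤ N) (hθ : 0 < θ) (hp : 0 < p) (η : Config K N) (i : ZMod K) :
    0 < jumpRate θ p η i (i + 1) := by
  have : (0 : ℝ) ≤ (N : ℝ) - 1 := by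
    have : (2 : ℝ) ≤ N := by exact_mod_cast hN
    linarith
  unfold jumpRate
  rw [if_pos rfl]
  positivity

theorem generator_term_nonpos (hN : 2 ≤ N) (hθ : 0 < θ) (hp : 0 < p) {f : Config K N → ℝ}
    {η : Config K N} (h : ∀ ξ, f ξ ≤ f η) (i j : ZMod K) :
    (η.1 i : ℝ) * (f (η.move i j) - f η) * jumpRate θ p η i j ≤ 0 :=
  mul_nonpos_of_nonpos_of_nonneg
    (mul_nonpos_of_nonneg_of_nonpos (Nat.cast_nonneg _) (sub_nonpos.mpr (h _)))
    (jumpRate_nonneg hN hθ hp η i j)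

theorem generator_nonpos_of_max (hN : 2 ≤ N) (hθ : 0 < θ) (hp : 0 < p) (f : Config K N → ℝ)
    (η : Config K N) (h : ∀ ξ, f ξ ≤ f η) : generator θ p f η ≤ 0 :=
  Finset.sum_nonpos fun i _ => Finset.sum_nonpos fun j _ =>
    generator_term_nonpos hN hθ hp h i j

/-- The generator as a linear map. -/
noncomputable def generatorLinear (K N : ℕ) [NeZero K] (θ p : ℝ) :
    (Config K N → ℝ) →ₗ[ℝ] (Config K N → ℝ) where
  toFun := generator θ p
  map_add' f g := by
    funext η
    simp only [generator, Pi.add_apply, ← Finset.sum_add_distrib]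
    exact Finset.sum_congr rfl fun i _ => Finset.sum_congr rfl fun j _ => by ring
  map_smul' c f := by
    funext η
    simp only [generator, Pi.smul_apply, smul_eq_mul, Finset.mul_sum, RingHom.id_apply]
    exact Finset.sum_congr rfl fun i _ => Finset.sum_congr rfl fun j _ => by ring

/-- At a maximum of `f` all terms of the generator are nonpositive with zero sum, so each vanishes.
Clockwise rates are positive, so the set of maximum points is closed under clockwise moves. -/
theorem max_eq_single_of_generator_eq_zero (hN : 2 ≤ N) (hθ : 0 < θ) (hp : 0 < p)
    {f : Config K N → ℝ} (hf : generator θ p f = 0) :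
    ∃ η : Config K N, η.1 = Pi.single 0 N ∧ ∀ ξ, f ξ ≤ f η := by
  obtain ⟨η, hη, h0⟩ := Config.exists_mem_of_closed (s := {η | ∀ ξ, f ξ ≤ f η})
    (Finite.exists_max f) (by
      intro η hη i hi ξ
      refine (hη ξ).trans (le_of_eq ?_)
      have h1 := congrFun hf η
      simp only [generator, Pi.zero_apply] at h1
      rw [Finset.sum_eq_zero_iff_of_nonpos fun i _ => Finset.sum_nonpos fun j _ =>
        generator_term_nonpos hN hθ hp hη i j] at h1
      have h2 := h1 i (Finset.mem_univ i)
      rw [Finset.sum_eq_zero_iff_of_nonpos fun j _ =>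
        generator_term_nonpos hN hθ hp hη i j] at h2
      have h3 := h2 (i + 1) (Finset.mem_univ _)
      have hi' : (η.1 i : ℝ) ≠ 0 := by exact_mod_cast hi.ne'
      have h4 := (jumpRate_succ_pos hN hθ hp η i).ne'
      simp only [mul_eq_zero, hi', h4, false_or, or_false] at h3
      linarith)
  exact ⟨η, h0, hη⟩

/-- The same configuration is a maximum point of both `f` and `-f`. -/
theorem eq_of_generator_eq_zero (hN : 2 ≤ N) (hθ : 0 < θ) (hp : 0 < p) {f : Config K N → ℝ}
    (hf : generator θ p f = 0) (η ξ : Config K N) : f η = f ξ := by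
  obtain ⟨a, ha, hmax⟩ := max_eq_single_of_generator_eq_zero hN hθ hp hf
  have hf' : generator θ p (-f) = 0 := by
    have : generatorLinear K N θ p (-f) = 0 := by
      rw [map_neg, show generatorLinear K N θ p f = 0 from hf, neg_zero]
    exact this
  obtain ⟨b, hb, hmin⟩ := max_eq_single_of_generator_eq_zero hN hθ hp hf'
  have hab : a = b := Subtype.ext (ha.trans hb.symm)
  subst hab
  have hconst : ∀ ζ, f ζ = f a := fun ζ =>
    le_antisymm (hmax ζ) (neg_le_neg_iff.mp (hmin ζ))
  rw [hconst η, hconst ξ]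

theorem existsUnique_isStationaryDistribution (hN : 2 ≤ N) (hθ : 0 < θ) (hp : 0 < p) :
    ∃! ν : MeasureTheory.Measure (Config K N), IsStationaryDistribution θ p ν := by
  classical
  have := Fintype.ofFinite (Config K N)
  obtain ⟨μ, hpos, hG, h1, hdec⟩ :=
    exists_positive_functional_of_max_principle (generatorLinear K N θ p)
      (generator_nonpos_of_max hN hθ hp) (fun g hg => eq_of_generator_eq_zero hN hθ hp hg)
  have hμ : ∀ f, ∑ η, μ (Pi.single η 1) * f η = μ f := by
    intro f
    conv_rhs => rw [pi_eq_sum_univ' f, map_sum]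
    refine Finset.sum_congr rfl fun η _ => ?_
    rw [map_smul, smul_eq_mul, mul_comm]
  have hw : ∀ η, 0 ≤ μ (Pi.single η 1) := fun η => hpos _ fun ξ => by
    rw [Pi.single_apply]
    split_ifs <;> norm_num
  let ν : MeasureTheory.Measure (Config K N) :=
    ∑ η, ENNReal.ofReal (μ (Pi.single η 1)) • MeasureTheory.Measure.dirac η
  have hν : MeasureTheory.IsProbabilityMeasure ν := by
    constructor
    simp only [ν, MeasureTheory.Measure.coe_finsetSum, Finset.sum_apply,
      MeasureTheory.Measure.smul_apply, MeasureTheory.measure_univ, smul_eq_mul, mul_one]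
    rw [← ENNReal.ofReal_sum_of_nonneg fun η _ => hw η, ← ENNReal.ofReal_one]
    congr 1
    simpa [h1] using hμ 1
  have hint : ∀ f : Config K N → ℝ, ∫ η, f η ∂ν = μ f := by
    intro f
    rw [← hμ f]
    simp only [ν]
    have hfin : ∀ η : Config K N, MeasureTheory.IsFiniteMeasure
        (ENNReal.ofReal (μ (Pi.single η 1)) • MeasureTheory.Measure.dirac η) := fun η =>
      MeasureTheory.Measure.smul_finite _ ENNReal.ofReal_ne_top
    rw [MeasureTheory.integral_finsetSum_measure fun η _ =>
      MeasureTheory.Integrable.of_finite]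
    refine Finset.sum_congr rfl fun η _ => ?_
    rw [MeasureTheory.integral_smul_measure, MeasureTheory.integral_dirac,
      ENNReal.toReal_ofReal (hw η), smul_eq_mul]
  -- Integrating `f = L g + μ f` against a stationary `ρ` leaves only `μ f`.
  have huniq : ∀ ρ : MeasureTheory.Measure (Config K N), IsStationaryDistribution θ p ρ →
      ∀ f : Config K N → ℝ, ∫ η, f η ∂ρ = μ f := by
    intro ρ hρ f
    have := hρ.isProbabilityMeasure
    obtain ⟨g, hg⟩ := hdec f
    have h2 : ∫ η, f η ∂ρ = ∫ η, (generator θ p g η + μ f) ∂ρ :=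
      congrArg (fun F : Config K N → ℝ => ∫ η, F η ∂ρ) hg
    rw [h2, MeasureTheory.integral_add MeasureTheory.Integrable.of_finite
      MeasureTheory.Integrable.of_finite, hρ.integral_generator g]
    simp
  refine ⟨ν, ⟨hν, fun f => (hint _).trans (hG f)⟩, fun ρ hρ => ?_⟩
  have := hρ.isProbabilityMeasure
  refine MeasureTheory.Measure.ext_of_singleton fun η => ?_
  have h2 := (huniq ρ hρ (Set.indicator {η} 1)).trans (hint (Set.indicator {η} 1)).symm
  rw [MeasureTheory.integral_indicator_one (MeasurableSet.singleton η),
    MeasureTheory.integral_indicator_one (MeasurableSet.singleton η)] at h2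
  exact (MeasureTheory.measureReal_eq_measureReal_iff).mp h2

end Generator

/-! ### Closed equations for the first and second moments -/

section Moments

open MeasureTheory

variable {K N : ℕ} [NeZero K] {θ p : ℝ}

theorem Config.mul_move_sub (η : Config K N) (i j a : ZMod K) :
    (η.1 i : ℝ) * (((η.move i j).1 a : ℝ) - η.1 a) =
      η.1 i * ((if j = a then 1 else 0) - (if i = a then 1 else 0)) := by
  rcases Nat.eq_zero_or_pos (η.1 i) with h | h
  · simp [h]
  · rw [move_apply h]
    ring

theorem Config.mul_move_mul_sub (η : Config K N) (i j a b : ZMod K) :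
    (η.1 i : ℝ) * (((η.move i j).1 a : ℝ) * (η.move i j).1 b - η.1 a * η.1 b) =
      η.1 i * (η.1 a * ((if j = b then 1 else 0) - (if i = b then 1 else 0)) +
        η.1 b * ((if j = a then 1 else 0) - (if i = a then 1 else 0)) +
        ((if j = a then 1 else 0) - (if i = a then 1 else 0)) *
          ((if j = b then 1 else 0) - (if i = b then 1 else 0))) := by
  rcases Nat.eq_zero_or_pos (η.1 i) with h | h
  · simp [h]
  · rw [move_apply h, move_apply h]
    ring

/-- Inflow minus outflow at `a`; the diagonal jumps `i = j` contribute to both and cancel. -/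
theorem sum_flux {ι : Type*} [Fintype ι] [DecidableEq ι] (x : ι → ℝ) (r : ι → ι → ℝ) (a : ι) :
    ∑ i, ∑ j, x i * ((if j = a then 1 else 0) - (if i = a then 1 else 0)) * r i j =
      ∑ i, x i * r i a - x a * ∑ j, r a j := by
  simp only [mul_sub, sub_mul, mul_ite, ite_mul, mul_one, mul_zero, zero_mul,
    Finset.sum_sub_distrib, Finset.sum_ite_eq', Finset.mem_univ, if_true]
  congr 1
  rw [Finset.sum_comm]
  simp [Finset.mul_sum]

/-- The carré du champ of two coordinates: on the diagonal every jump into or out of `a` counts, off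
it only exchanges between `a` and `b`, with negative sign. -/
theorem sum_flux_mul {ι : Type*} [Fintype ι] [DecidableEq ι] (x : ι → ℝ) (r : ι → ι → ℝ)
    (a b : ι) :
    ∑ i, ∑ j, x i * (((if j = a then 1 else 0) - (if i = a then 1 else 0)) *
        ((if j = b then 1 else 0) - (if i = b then 1 else 0))) * r i j =
      (if a = b then ∑ i, x i * r i a + x a * ∑ j, r a j else 0) - x a * r a b - x b * r b a := by
  have hterm : ∀ i j, x i * (((if j = a then 1 else 0) - (if i = a then 1 else 0)) *
        ((if j = b then 1 else 0) - (if i = b then 1 else 0))) * r i j =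
      (if j = a then (if a = b then x i * r i a else 0) else 0)
        - (if i = a then (if j = b then x a * r a b else 0) else 0)
        - (if i = b then (if j = a then x b * r b a else 0) else 0)
        + (if i = a then (if a = b then x a * r a j else 0) else 0) := by
    intro i j
    by_cases h1 : j = a <;> by_cases h2 : i = a <;> by_cases h3 : j = b <;> by_cases h4 : i = b <;>
      subst_vars <;> simp_all
  simp only [hterm, Finset.sum_add_distrib, Finset.sum_sub_distrib, Finset.sum_ite_eq',
    Finset.mem_univ, if_true]
  have hrow : ∀ (c : ι) (F : ι → ℝ), ∑ i, ∑ j, (if i = c then F j else 0) = ∑ j, F j := by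
    intro c F
    rw [Finset.sum_comm]
    simp
  rw [hrow a fun j => if j = b then x a * r a b else 0,
    hrow b fun j => if j = a then x b * r b a else 0,
    hrow a fun j => if a = b then x a * r a j else 0]
  by_cases hab : a = b
  · simp [hab, Finset.mul_sum]
    ring
  · simp [hab]

theorem sum_mul_jumpRate (η : Config K N) (a : ZMod K) :
    ∑ i, (η.1 i : ℝ) * jumpRate θ p η i a =
      η.1 (a - 1) + θ * η.1 (a + 1) + p * N / ((N : ℝ) - 1) * η.1 a := by
  have h1 : ∀ i : ZMod K, a = i + 1 ↔ i = a - 1 := fun i => by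
    rw [eq_comm, eq_sub_iff_add_eq]
  have h2 : ∀ i : ZMod K, a = i - 1 ↔ i = a + 1 := fun i => by
    rw [eq_comm, sub_eq_iff_eq_add]
  simp only [jumpRate, mul_add, Finset.sum_add_distrib, h1, h2, mul_ite, mul_one, mul_zero,
    Finset.sum_ite_eq', Finset.mem_univ, if_true, ← Finset.sum_mul, Config.sum_coe]
  ring

theorem sum_jumpRate (η : Config K N) (a : ZMod K) :
    ∑ j, jumpRate θ p η a j = 1 + θ + p * N / ((N : ℝ) - 1) := by
  simp only [jumpRate, Finset.sum_add_distrib, ← Finset.mul_sum, ← Finset.sum_div,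
    Config.sum_coe, Finset.sum_ite_eq', Finset.mem_univ, if_true]
  ring

/-- Killing brings particles into `a` and removes them at the same total rate, so `p` disappears. -/
theorem generator_coord (a : ZMod K) (η : Config K N) :
    generator θ p (fun ξ => (ξ.1 a : ℝ)) η =
      η.1 (a - 1) + θ * η.1 (a + 1) - (1 + θ) * η.1 a := by
  simp only [generator, Config.mul_move_sub]
  rw [sum_flux (fun i => (η.1 i : ℝ)), sum_mul_jumpRate, sum_jumpRate]
  ring

/-- The cubic killing terms cancel as for single coordinates; what remains of killing comes from the
carré du champ and is at most quadratic. -/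
theorem generator_coord_mul (a b : ZMod K) (η : Config K N) :
    generator θ p (fun ξ => (ξ.1 a : ℝ) * ξ.1 b) η =
      η.1 a * η.1 (b - 1) + θ * (η.1 a * η.1 (b + 1)) +
        (η.1 (a - 1) * η.1 b + θ * (η.1 (a + 1) * η.1 b)) -
        (2 * (1 + θ) + 2 * p / ((N : ℝ) - 1)) * (η.1 a * η.1 b) +
        (if a = b then 1 else 0) * (η.1 (a - 1) + θ * η.1 (a + 1) +
          (1 + θ + 2 * (p * N / ((N : ℝ) - 1))) * η.1 a) -
        ((if b = a + 1 then 1 else 0) + θ * (if b = a - 1 then 1 else 0)) * η.1 a -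
        ((if a = b + 1 then 1 else 0) + θ * (if a = b - 1 then 1 else 0)) * η.1 b := by
  simp only [generator, Config.mul_move_mul_sub]
  have hsplit : ∀ i j : ZMod K, (η.1 i : ℝ) *
      (η.1 a * ((if j = b then 1 else 0) - (if i = b then 1 else 0)) +
        η.1 b * ((if j = a then 1 else 0) - (if i = a then 1 else 0)) +
        ((if j = a then 1 else 0) - (if i = a then 1 else 0)) *
          ((if j = b then 1 else 0) - (if i = b then 1 else 0))) * jumpRate θ p η i j =
      η.1 a * (η.1 i * ((if j = b then 1 else 0) - (if i = b then 1 else 0)) * jumpRate θ p η i j) +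
      η.1 b * (η.1 i * ((if j = a then 1 else 0) - (if i = a then 1 else 0)) * jumpRate θ p η i j) +
      η.1 i * (((if j = a then 1 else 0) - (if i = a then 1 else 0)) *
          ((if j = b then 1 else 0) - (if i = b then 1 else 0))) * jumpRate θ p η i j :=
    fun i j => by ring
  simp only [hsplit, Finset.sum_add_distrib, ← Finset.mul_sum]
  rw [sum_flux (fun i => (η.1 i : ℝ)), sum_flux (fun i => (η.1 i : ℝ)),
    sum_flux_mul (fun i => (η.1 i : ℝ))]
  simp only [sum_mul_jumpRate, sum_jumpRate]
  simp only [jumpRate]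
  split_ifs <;> ring

namespace IsStationaryDistribution

variable {ν : Measure (Config K N)}

theorem mean_balance (hν : IsStationaryDistribution θ p ν) (a : ZMod K) :
    ∫ η, (η.1 (a - 1) : ℝ) ∂ν + θ * ∫ η, (η.1 (a + 1) : ℝ) ∂ν =
      (1 + θ) * ∫ η, (η.1 a : ℝ) ∂ν := by
  have := hν.isProbabilityMeasure
  have h := hν.integral_generator fun ξ => (ξ.1 a : ℝ)
  simp only [generator_coord] at h
  rw [integral_sub .of_finite .of_finite, integral_add .of_finite .of_finite,
    integral_const_mul, integral_const_mul] at h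
  linarith

theorem mean_eq (hν : IsStationaryDistribution θ p ν) (hθ : 0 < θ) (a : ZMod K) :
    ∫ η, (η.1 a : ℝ) ∂ν = (N : ℝ) / K := by
  have := hν.isProbabilityMeasure
  set m : ZMod K → ℝ := fun a => ∫ η, (η.1 a : ℝ) ∂ν with hm
  have hbal : ∀ a, m (a - 1) + θ * m (a + 1) = (1 + θ) * m a := hν.mean_balance
  obtain ⟨c, hc⟩ := Finite.exists_max m
  -- At a maximum, the balance equation is a weighted average of neighbours, so the maximum
  -- propagates to `c - 1`, and on around the cycle.
  have hstep : ∀ n : ℕ, m (c - n) = m c := by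
    intro n
    induction n with
    | zero => simp
    | succ n ih =>
      have h1 := hbal (c - n)
      have h2 := hc (c - n + 1)
      have h3 := hc (c - n - 1)
      rw [ih] at h1
      have h4 : m (c - n - 1) = m c := by nlinarith
      rw [← h4]
      congr 1
      push_cast
      ring
  have hall : ∀ b, m b = m c := by
    intro b
    have := hstep (c - b).val
    rwa [ZMod.natCast_val, ZMod.cast_id', id, sub_sub_cancel] at this
  have hsum : ∑ b, m b = N := by
    simp only [hm]
    rw [← integral_finsetSum _ fun _ _ => .of_finite]
    simp [Config.sum_coe]
  have hK : (K : ℝ) ≠ 0 := Nat.cast_ne_zero.mpr (NeZero.ne K)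
  simp only [hall, Finset.sum_const, Finset.card_univ, ZMod.card, nsmul_eq_mul] at hsum
  rw [eq_div_iff hK, ← hsum]
  have : ∫ η, (η.1 a : ℝ) ∂ν = m c := hall a
  rw [this]
  ring

theorem second_moment_balance (hν : IsStationaryDistribution θ p ν) (hθ : 0 < θ) (a b : ZMod K) :
    ∫ η, (η.1 a : ℝ) * η.1 (b - 1) ∂ν + θ * ∫ η, (η.1 a : ℝ) * η.1 (b + 1) ∂ν +
      (∫ η, (η.1 (a - 1) : ℝ) * η.1 b ∂ν + θ * ∫ η, (η.1 (a + 1) : ℝ) * η.1 b ∂ν) -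
      (2 * (1 + θ) + 2 * p / ((N : ℝ) - 1)) * ∫ η, (η.1 a : ℝ) * η.1 b ∂ν +
      ((if a = b then 2 * (1 + θ) + 2 * (p * N / ((N : ℝ) - 1)) else 0) -
        ((if b = a + 1 then 1 else 0) + (if b = a - 1 then 1 else 0)) * (1 + θ)) * (N / K) = 0 := by
  have := hν.isProbabilityMeasure
  have h := hν.integral_generator fun ξ => (ξ.1 a : ℝ) * ξ.1 b
  simp only [generator_coord_mul] at h
  rw [integral_sub .of_finite .of_finite, integral_sub .of_finite .of_finite,
    integral_add .of_finite .of_finite, integral_sub .of_finite .of_finite,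
    integral_add .of_finite .of_finite, integral_add .of_finite .of_finite,
    integral_add .of_finite .of_finite] at h
  simp only [integral_const_mul] at h
  rw [integral_add .of_finite .of_finite, integral_add .of_finite .of_finite] at h
  simp only [integral_const_mul, hν.mean_eq hθ] at h
  have h1 : a = b + 1 ↔ b = a - 1 := by rw [eq_comm, eq_sub_iff_add_eq]
  have h2 : a = b - 1 ↔ b = a + 1 := by rw [eq_comm, sub_eq_iff_eq_add]
  simp only [h1, h2] at h
  refine Eq.trans ?_ h
  split_ifs <;> ring

/-- Second moments are invariant under rotations of the cycle. -/
theorem second_moment_add_one (hν : IsStationaryDistribution θ p ν) (hN : 2 ≤ N) (hθ : 0 < θ)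
    (hp : 0 < p) (a b : ZMod K) :
    ∫ η, (η.1 (a + 1) : ℝ) * η.1 (b + 1) ∂ν = ∫ η, (η.1 a : ℝ) * η.1 b ∂ν := by
  set T : ZMod K × ZMod K → ℝ := fun x => ∫ η, (η.1 x.1 : ℝ) * η.1 x.2 ∂ν with hT
  set D : ZMod K × ZMod K → ℝ := fun x => T (x.1 + 1, x.2 + 1) - T x with hD
  have hN' : (0 : ℝ) < 2 * p / ((N : ℝ) - 1) := by
    have : (2 : ℝ) ≤ N := by exact_mod_cast hN
    have : (0 : ℝ) < (N : ℝ) - 1 := by linarith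
    positivity
  -- The source depends only on `b - a`, so it drops out of the difference. The strictly positive
  -- killing rate then forces the maximum and the minimum of `D` to be zero.
  have hbal : ∀ a b, D (a, b - 1) + θ * D (a, b + 1) + D (a - 1, b) + θ * D (a + 1, b) =
      (2 * (1 + θ) + 2 * p / ((N : ℝ) - 1)) * D (a, b) := by
    intro a b
    have h0 := hν.second_moment_balance hθ a b
    have h1 := hν.second_moment_balance hθ (a + 1) (b + 1)
    have e1 : a + 1 - 1 = a - 1 + 1 := by ring
    have e2 : b + 1 - 1 = b - 1 + 1 := by ring
    simp only [e1, e2, add_left_inj] at h1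
    simp only [hD, hT]
    linear_combination h1 - h0
  obtain ⟨⟨a₁, b₁⟩, hmax⟩ := Finite.exists_max D
  obtain ⟨⟨a₂, b₂⟩, hmin⟩ := Finite.exists_min D
  have hle : D (a₁, b₁) ≤ 0 := by
    have h := hbal a₁ b₁
    have h1 := hmax (a₁, b₁ - 1)
    have h2 := mul_le_mul_of_nonneg_left (hmax (a₁, b₁ + 1)) hθ.le
    have h3 := hmax (a₁ - 1, b₁)
    have h4 := mul_le_mul_of_nonneg_left (hmax (a₁ + 1, b₁)) hθ.le
    by_contra! hpos
    have := mul_pos hN' hpos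
    linarith
  have hge : 0 ≤ D (a₂, b₂) := by
    have h := hbal a₂ b₂
    have h1 := hmin (a₂, b₂ - 1)
    have h2 := mul_le_mul_of_nonneg_left (hmin (a₂, b₂ + 1)) hθ.le
    have h3 := hmin (a₂ - 1, b₂)
    have h4 := mul_le_mul_of_nonneg_left (hmin (a₂ + 1, b₂)) hθ.le
    by_contra! hneg
    have := mul_neg_of_pos_of_neg hN' hneg
    linarith
  have h0 : D (a, b) = 0 :=
    le_antisymm ((hmax _).trans hle) (hge.trans (hmin _))
  exact sub_eq_zero.mp h0

/-- By rotation invariance each neighbour `k ± 1` receives weight `1` from one of the two particles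
and `θ` from the other, so the asymmetric drift becomes a symmetric Laplacian. -/
theorem correlation_balance (hν : IsStationaryDistribution θ p ν) (hN : 2 ≤ N) (hθ : 0 < θ)
    (hp : 0 < p) (k : ZMod K) :
    (1 + θ) * (∫ η, (η.1 0 : ℝ) * η.1 (k + 1) ∂ν + ∫ η, (η.1 0 : ℝ) * η.1 (k - 1) ∂ν -
        2 * ∫ η, (η.1 0 : ℝ) * η.1 k ∂ν) -
      2 * p / ((N : ℝ) - 1) * ∫ η, (η.1 0 : ℝ) * η.1 k ∂ν +
      ((if k = 0 then 2 * (1 + θ) + 2 * (p * N / ((N : ℝ) - 1)) else 0) -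
        ((if k = 1 then 1 else 0) + (if k = -1 then 1 else 0)) * (1 + θ)) * (N / K) = 0 := by
  have h := hν.second_moment_balance hθ 0 k
  have h1 := hν.second_moment_add_one hN hθ hp (0 - 1) k
  have h2 := hν.second_moment_add_one hN hθ hp 0 (k - 1)
  rw [sub_add_cancel] at h1 h2
  rw [h2, ← h1] at h
  simp only [zero_add, zero_sub, eq_comm (a := (0 : ZMod K))] at h
  linear_combination h

theorem sum_correlation (hν : IsStationaryDistribution θ p ν) (hθ : 0 < θ) :
    ∑ k, ∫ η, (η.1 0 : ℝ) * η.1 k ∂ν = (N : ℝ) * (N / K) := by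
  have := hν.isProbabilityMeasure
  rw [← integral_finsetSum _ fun _ _ => .of_finite]
  simp only [← Finset.mul_sum, Config.sum_coe, integral_mul_const, hν.mean_eq hθ]
  ring

theorem covariance_eq (hν : IsStationaryDistribution θ p ν) (hN : 2 ≤ N) (hθ : 0 < θ)
    (k : ZMod K) :
    cov[fun η : Config K N => (η.1 0 : ℝ) / (N : ℝ), fun η : Config K N => (η.1 k : ℝ) / (N : ℝ); ν]
      = (∫ η, (η.1 0 : ℝ) * η.1 k ∂ν) / (N : ℝ) ^ 2 - 1 / (K : ℝ) ^ 2 := by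
  have := hν.isProbabilityMeasure
  have hN' : (N : ℝ) ≠ 0 := Nat.cast_ne_zero.mpr (by omega)
  rw [ProbabilityTheory.covariance_eq_sub .of_discrete .of_discrete]
  simp only [Pi.mul_apply, integral_div, hν.mean_eq hθ, div_mul_div_comm]
  field_simp

end IsStationaryDistribution

end Moments

/-! ### Discrete Poisson equation on the cycle -/

section Cycle

variable {K : ℕ} [NeZero K]

/-- A sum-free function on the cycle is controlled by its gradient. -/
theorem sq_le_of_sum_eq_zero {e : ZMod K → ℝ} (he : ∑ k, e k = 0) (k : ZMod K) :
    e k ^ 2 ≤ 4 * (K : ℝ) ^ 2 * ∑ j, (e (j + 1) - e j) ^ 2 := by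
  set E := ∑ j, (e (j + 1) - e j) ^ 2 with hE
  have hE0 : 0 ≤ E := Finset.sum_nonneg fun _ _ => sq_nonneg _
  have hgrad : ∀ j, |e (j + 1) - e j| ≤ √E := fun j =>
    Real.abs_le_sqrt (Finset.single_le_sum (f := fun j => (e (j + 1) - e j) ^ 2)
      (fun _ _ => sq_nonneg _) (Finset.mem_univ j))
  have hdist : ∀ n : ℕ, |e n - e 0| ≤ n * √E := by
    intro n
    induction n with
    | zero => simp
    | succ n ih =>
      have h1 := hgrad n
      have h2 := abs_add_le (e (n + 1) - e n) (e n - e 0)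
      rw [sub_add_sub_cancel] at h2
      push_cast
      linarith
  have hK : (0 : ℝ) < K := Nat.cast_pos.mpr (NeZero.pos K)
  have hzero : ∀ j, |e j - e 0| ≤ K * √E := by
    intro j
    have h1 := hdist j.val
    rw [ZMod.natCast_val, ZMod.cast_id', id] at h1
    refine h1.trans (mul_le_mul_of_nonneg_right ?_ (Real.sqrt_nonneg _))
    exact_mod_cast (ZMod.val_lt j).le
  -- The zero sum turns control of the oscillation into control of `e 0`.
  have h0 : |e 0| ≤ K * √E := by
    have h1 : ∑ j, (e j - e 0) = -(K * e 0) := by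
      rw [Finset.sum_sub_distrib, he]
      simp
    have h2 : |∑ j, (e j - e 0)| ≤ K * (K * √E) := by
      refine (Finset.abs_sum_le_sum_abs _ _).trans ((Finset.sum_le_sum fun j _ => hzero j).trans ?_)
      simp
    rw [h1, abs_neg, abs_mul, abs_of_pos hK] at h2
    exact le_of_mul_le_mul_left h2 hK
  have hk : |e k| ≤ 2 * K * √E := by
    have h1 := abs_add_le (e k - e 0) (e 0)
    rw [sub_add_cancel] at h1
    linarith [hzero k]
  calc e k ^ 2 = |e k| ^ 2 := (sq_abs _).symm
    _ ≤ (2 * K * √E) ^ 2 := pow_le_pow_left₀ (abs_nonneg _) hk 2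
    _ = 4 * (K : ℝ) ^ 2 * E := by
      rw [mul_pow, Real.sq_sqrt hE0]
      ring

theorem sum_mul_laplacian (e : ZMod K → ℝ) :
    ∑ k, e k * (e (k + 1) + e (k - 1) - 2 * e k) = -∑ k, (e (k + 1) - e k) ^ 2 := by
  have h1 : ∑ k, e (k + 1) ^ 2 = ∑ k, e k ^ 2 :=
    Equiv.sum_comp (Equiv.addRight (1 : ZMod K)) fun k => e k ^ 2
  have h2 : ∑ k, e k * e (k - 1) = ∑ k, e k * e (k + 1) := by
    rw [← Equiv.sum_comp (Equiv.addRight (1 : ZMod K)) fun k => e k * e (k - 1)]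
    simp [mul_comm]
  have h3 : ∀ k, e k * (e (k + 1) + e (k - 1) - 2 * e k) =
      e k * e (k + 1) + e k * e (k - 1) - 2 * e k ^ 2 := fun k => by ring
  have h4 : ∀ k, (e (k + 1) - e k) ^ 2 = e (k + 1) ^ 2 - 2 * (e k * e (k + 1)) + e k ^ 2 :=
    fun k => by ring
  simp only [h3, h4, Finset.sum_add_distrib, Finset.sum_sub_distrib, ← Finset.mul_sum, h1, h2]
  ring

/-- Stability, uniform in the killing rate `β`, of the discrete Poisson equation on the cycle. -/
theorem abs_le_of_laplacian_sub {e : ZMod K → ℝ} (he : ∑ k, e k = 0) {α β R : ℝ} (hα : 0 < α)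
    (hβ : 0 ≤ β) (hR : ∀ k, |α * (e (k + 1) + e (k - 1) - 2 * e k) - β * e k| ≤ R) (k : ZMod K) :
    |e k| ≤ 4 * (K : ℝ) ^ 3 * R / α := by
  obtain ⟨c, hc⟩ := Finite.exists_max fun k => |e k|
  refine (hc k).trans ?_
  set M := |e c| with hM
  set E := ∑ j, (e (j + 1) - e j) ^ 2 with hE
  have hR0 : 0 ≤ R := (abs_nonneg _).trans (hR 0)
  -- Testing the equation against `e`: the killing term has a favourable sign and is discarded,
  -- which is why `β` does not enter the bound.
  have h1 : ∑ k, e k * (α * (e (k + 1) + e (k - 1) - 2 * e k) - β * e k) =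
      -(α * E) - β * ∑ k, e k ^ 2 := by
    have hterm : ∀ k, e k * (α * (e (k + 1) + e (k - 1) - 2 * e k) - β * e k) =
        α * (e k * (e (k + 1) + e (k - 1) - 2 * e k)) - β * e k ^ 2 := fun k => by ring
    simp only [hterm, Finset.sum_sub_distrib, ← Finset.mul_sum, sum_mul_laplacian]
    ring
  have h2 : |∑ k, e k * (α * (e (k + 1) + e (k - 1) - 2 * e k) - β * e k)| ≤ K * (M * R) := by
    refine (Finset.abs_sum_le_sum_abs _ _).trans ?_
    refine (Finset.sum_le_sum (g := fun _ => M * R) fun j _ => ?_).trans (by simp)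
    rw [abs_mul]
    exact mul_le_mul (hc j) (hR j) (abs_nonneg _) (abs_nonneg _)
  have h3 : α * E ≤ K * (M * R) := by
    have h4 : 0 ≤ β * ∑ k, e k ^ 2 := mul_nonneg hβ (Finset.sum_nonneg fun _ _ => sq_nonneg _)
    have h5 := (neg_le_abs _).trans h2
    linarith
  have h4 : M ^ 2 ≤ 4 * (K : ℝ) ^ 2 * E := by
    rw [hM, sq_abs]
    exact sq_le_of_sum_eq_zero he c
  have h5 : M * (M * α) ≤ M * (4 * (K : ℝ) ^ 3 * R) := by
    calc M * (M * α) = M ^ 2 * α := by ring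
      _ ≤ 4 * (K : ℝ) ^ 2 * E * α := mul_le_mul_of_nonneg_right h4 hα.le
      _ = 4 * (K : ℝ) ^ 2 * (α * E) := by ring
      _ ≤ 4 * (K : ℝ) ^ 2 * (K * (M * R)) := mul_le_mul_of_nonneg_left h3 (by positivity)
      _ = M * (4 * (K : ℝ) ^ 3 * R) := by ring
  rw [le_div_iff₀ hα]
  rcases (abs_nonneg (e c)).eq_or_lt with h0 | h0
  · rw [hM, ← h0, zero_mul]
    positivity
  · exact le_of_mul_le_mul_left h5 h0

theorem ZMod.sum_val {M : Type*} [AddCommMonoid M] (f : ℕ → M) :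
    ∑ k : ZMod K, f k.val = ∑ n ∈ Finset.range K, f n := by
  obtain _ | n := K
  · exact absurd rfl (NeZero.ne 0)
  · exact Fin.sum_univ_eq_sum_range f (n + 1)

/-- The second difference of a periodised function. -/
theorem laplacian_val {f : ℝ → ℝ} (hf : f K = f 0) (k : ZMod K) :
    f (k + 1).val + f (k - 1).val - 2 * f k.val =
      f (k.val + 1) + f (k.val - 1) - 2 * f k.val + if k = 0 then f (K - 1) - f (-1) else 0 := by
  have h1 : f (k + 1).val = f (k.val + 1) := by
    rcases ZMod.val_add_one_cases k with h | ⟨h, h'⟩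
    · rw [h]
      push_cast
      rfl
    · have hK : (k.val : ℝ) + 1 = K := by exact_mod_cast h
      rw [h', Nat.cast_zero, ← hf, hK]
  have h2 : f (k - 1).val = f (k.val - 1) + if k = 0 then f (K - 1) - f (-1) else 0 := by
    have hsucc := ZMod.val_add_one_cases (k - 1)
    rw [sub_add_cancel] at hsucc
    rcases hsucc with h | ⟨h, h'⟩
    · have hk : k ≠ 0 := fun hk => by simp [hk] at h
      rw [if_neg hk, h]
      simp
    · have hk : k = 0 := (ZMod.val_eq_zero k).mp h'
      have hK : ((k - 1).val : ℝ) = K - 1 := by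
        rw [eq_sub_iff_add_eq]
        exact_mod_cast h
      rw [if_pos hk, h', hK]
      simp
  rw [h1, h2]
  ring

end Cycle

/-! ### Poisson equations and zero sums for the coefficients -/

section Coefficients

variable {K : ℕ} [NeZero K] {θ p : ℝ}

/-- The quadratic part has constant second difference; its kink at `0` produces `-2p/K` there. The
indicator part accounts for the sources carrying `1 + θ`. -/
theorem firstCoeff_laplacian (hθ : 0 < θ) (k : ZMod K) :
    (1 + θ) * (firstCoeff K θ p (k + 1).val + firstCoeff K θ p (k - 1).val
        - 2 * firstCoeff K θ p k.val) =
      2 * p / (K : ℝ) ^ 2 - (if k = 0 then 2 * (1 + θ) + 2 * p else 0) / K +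
        ((if k = 1 then 1 else 0) + (if k = -1 then 1 else 0)) * (1 + θ) / K := by
  have hK : (K : ℝ) ≠ 0 := Nat.cast_ne_zero.mpr (NeZero.ne K)
  have hθ' : θ + 1 ≠ 0 := by positivity
  have h := laplacian_val (K := K)
    (f := fun x => p * (6 * x * (x - K) + (K : ℝ) ^ 2 - 1) / (6 * (K : ℝ) ^ 2 * (θ + 1)))
    (by ring) k
  have hs : k + 1 = 0 ↔ k = -1 := by rw [eq_neg_iff_add_eq_zero]
  simp only [firstCoeff, ZMod.val_eq_zero, sub_eq_zero, hs]
  have h' := congrArg (fun x => (1 + θ) * x) h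
  have hrhs : (1 + θ) * (p * (6 * ((k.val : ℝ) + 1) * ((k.val : ℝ) + 1 - K) + (K : ℝ) ^ 2 - 1)
          / (6 * (K : ℝ) ^ 2 * (θ + 1)) +
        p * (6 * ((k.val : ℝ) - 1) * ((k.val : ℝ) - 1 - K) + (K : ℝ) ^ 2 - 1)
          / (6 * (K : ℝ) ^ 2 * (θ + 1)) -
        2 * (p * (6 * (k.val : ℝ) * ((k.val : ℝ) - K) + (K : ℝ) ^ 2 - 1)
          / (6 * (K : ℝ) ^ 2 * (θ + 1)))) = 2 * p / (K : ℝ) ^ 2 := by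
    field_simp
    ring
  have hbd : (1 + θ) * (p * (6 * ((K : ℝ) - 1) * ((K : ℝ) - 1 - K) + (K : ℝ) ^ 2 - 1)
          / (6 * (K : ℝ) ^ 2 * (θ + 1)) -
        p * (6 * (-1) * (-1 - (K : ℝ)) + (K : ℝ) ^ 2 - 1) / (6 * (K : ℝ) ^ 2 * (θ + 1))) =
      -(2 * p / K) := by
    field_simp
    ring
  simp only [mul_add (1 + θ) (_ + _ - _), hrhs, mul_ite, hbd, mul_zero] at h'
  by_cases h0 : k = 0
  · simp only [h0, if_true] at h' ⊢
    linear_combination h'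
  · simp only [h0, if_false] at h' ⊢
    linear_combination h'

theorem secondCoeff_laplacian (hθ : 0 < θ) (k : ZMod K) :
    (1 + θ) * (secondCoeff K θ p (k + 1).val + secondCoeff K θ p (k - 1).val
        - 2 * secondCoeff K θ p k.val) =
      2 * p * firstCoeff K θ p k.val + 2 * p / (K : ℝ) ^ 2 - (if k = 0 then 2 * p else 0) / K := by
  have hK : (K : ℝ) ≠ 0 := Nat.cast_ne_zero.mpr (NeZero.ne K)
  have hθ' : θ + 1 ≠ 0 := by positivity
  have h := laplacian_val (K := K)
    (f := fun x => p ^ 2 * (30 * x * ((K : ℝ) - x) * (x * ((K : ℝ) - x) + 2)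
        - ((K : ℝ) - 1) * ((K : ℝ) + 1) * ((K : ℝ) ^ 2 + 11))
      / (180 * (K : ℝ) ^ 2 * (θ + 1) ^ 2))
    (by ring) k
  simp only [secondCoeff, firstCoeff, ZMod.val_eq_zero]
  rw [h]
  -- The factor `x (K - x) (x (K - x) + 2)` agrees at `K - 1` and `-1`, so there is no kink; at `k =
  -- 0` the indicator in the first coefficient cancels the source.
  split_ifs
  · field_simp
    ring
  · field_simp
    ring

theorem sum_firstCoeff (hθ : 0 < θ) : ∑ k : ZMod K, firstCoeff K θ p k.val = 0 := by
  have hK : (K : ℝ) ≠ 0 := Nat.cast_ne_zero.mpr (NeZero.ne K)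
  have hθ' : θ + 1 ≠ 0 := by positivity
  have hpoly : ∀ n : ℕ, ∑ k ∈ Finset.range n, (6 * (k : ℝ) * ((k : ℝ) - K) + (K : ℝ) ^ 2 - 1) =
      n * (n - 1) * (2 * n - 1) - 3 * K * (n * (n - 1)) + n * ((K : ℝ) ^ 2 - 1) := by
    intro n
    induction n with
    | zero => simp
    | succ n ih =>
      rw [Finset.sum_range_succ, ih]
      push_cast
      ring
  rw [ZMod.sum_val (firstCoeff K θ p)]
  simp only [firstCoeff, Finset.sum_add_distrib, Finset.sum_sub_distrib, ← Finset.mul_sum,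
    ← Finset.sum_div, hpoly, Finset.sum_ite_eq', Finset.mem_range, NeZero.pos K, if_true,
    Finset.sum_const, Finset.card_range, nsmul_eq_mul]
  field_simp
  ring

theorem sum_secondCoeff : ∑ k : ZMod K, secondCoeff K θ p k.val = 0 := by
  -- The range `n` is decoupled from `K` so that induction applies; the right side combines the sums
  -- of the first four powers.
  have hpoly : ∀ n : ℕ, ∑ k ∈ Finset.range n,
      (30 * (k : ℝ) * ((K : ℝ) - k) * ((k : ℝ) * ((K : ℝ) - k) + 2)
        - ((K : ℝ) - 1) * ((K : ℝ) + 1) * ((K : ℝ) ^ 2 + 11)) =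
      30 * ((K : ℝ) ^ 2 * (n * (n - 1) * (2 * n - 1) / 6) - 2 * K * (n * (n - 1) / 2) ^ 2
        + n * (n - 1) * (2 * n - 1) * (3 * n ^ 2 - 3 * n - 1) / 30
        + 2 * K * (n * (n - 1) / 2) - 2 * (n * (n - 1) * (2 * n - 1) / 6))
        - n * (((K : ℝ) - 1) * ((K : ℝ) + 1) * ((K : ℝ) ^ 2 + 11)) := by
    intro n
    induction n with
    | zero => simp
    | succ n ih =>
      rw [Finset.sum_range_succ, ih]
      push_cast
      ring
  rw [ZMod.sum_val (secondCoeff K θ p)]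
  simp only [secondCoeff, ← Finset.mul_sum, ← Finset.sum_div, hpoly]
  rw [div_eq_zero_iff]
  left
  ring

end Coefficients

/-! ### Error estimate and conclusion -/

section Expansion

open MeasureTheory

variable {K : ℕ} [NeZero K] {θ p : ℝ}

theorem abs_covariance_sub_le (hθ : 0 < θ) (hp : 0 < p) {C : ℝ}
    (hC : ∀ k : ZMod K, |(if k = 0 then 2 * p else 0) / K - 2 * p / (K : ℝ) ^ 2
      - 2 * p * firstCoeff K θ p k.val - 2 * p * secondCoeff K θ p k.val| ≤ C)
    {N : ℕ} (hN : 2 ≤ N) {ν : Measure (Config K N)} (hν : IsStationaryDistribution θ p ν)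
    (k : ZMod K) :
    |cov[fun η : Config K N => (η.1 0 : ℝ) / (N : ℝ),
        fun η : Config K N => (η.1 k : ℝ) / (N : ℝ); ν]
      - (1 / (N : ℝ) * firstCoeff K θ p k.val + 1 / (N : ℝ) ^ 2 * secondCoeff K θ p k.val)| ≤
      8 * (K : ℝ) ^ 3 * C / (1 + θ) * (1 / (N : ℝ) ^ 3) := by
  have hK : (K : ℝ) ≠ 0 := Nat.cast_ne_zero.mpr (NeZero.ne K)
  have hN2 : (2 : ℝ) ≤ N := by exact_mod_cast hN
  have hN0 : (N : ℝ) ≠ 0 := by positivity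
  have hN1 : (0 : ℝ) < (N : ℝ) - 1 := by linarith
  have hC0 : 0 ≤ C := (abs_nonneg _).trans (hC 0)
  simp only [hν.covariance_eq hN hθ]
  set e : ZMod K → ℝ := fun k =>
    (∫ η, (η.1 0 : ℝ) * η.1 k ∂ν) / (N : ℝ) ^ 2 - 1 / (K : ℝ) ^ 2
      - (1 / (N : ℝ) * firstCoeff K θ p k.val + 1 / (N : ℝ) ^ 2 * secondCoeff K θ p k.val) with he
  have hsum : ∑ k, e k = 0 := by
    simp only [he, Finset.sum_sub_distrib, Finset.sum_add_distrib, ← Finset.sum_div,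
      ← Finset.mul_sum, hν.sum_correlation hθ, sum_firstCoeff hθ, sum_secondCoeff,
      Finset.sum_const, Finset.card_univ, ZMod.card, nsmul_eq_mul]
    field_simp
    ring
  have hres : ∀ k, |(1 + θ) * (e (k + 1) + e (k - 1) - 2 * e k) - 2 * p / ((N : ℝ) - 1) * e k| ≤
      2 * C * (1 / (N : ℝ) ^ 3) := by
    intro k
    have h0 := hν.correlation_balance hN hθ hp k
    have h1 := firstCoeff_laplacian (p := p) hθ k
    have h2 := secondCoeff_laplacian (p := p) hθ k
    -- The residual is exact: `1/(N-1) - 1/N - 1/N²` and `1/(N(N-1)) - 1/N²` both equal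
    -- `1/(N²(N-1))`.
    have hE : (1 + θ) * (e (k + 1) + e (k - 1) - 2 * e k) - 2 * p / ((N : ℝ) - 1) * e k =
        -((if k = 0 then 2 * p else 0) / K - 2 * p / (K : ℝ) ^ 2
          - 2 * p * firstCoeff K θ p k.val - 2 * p * secondCoeff K θ p k.val)
          * (1 / ((N : ℝ) ^ 2 * ((N : ℝ) - 1))) := by
      have hE1 : (1 + θ) * (e (k + 1) + e (k - 1) - 2 * e k) =
          1 / (N : ℝ) ^ 2 * ((1 + θ) * (∫ η, (η.1 0 : ℝ) * η.1 (k + 1) ∂ν +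
            ∫ η, (η.1 0 : ℝ) * η.1 (k - 1) ∂ν - 2 * ∫ η, (η.1 0 : ℝ) * η.1 k ∂ν))
          - 1 / (N : ℝ) * ((1 + θ) * (firstCoeff K θ p (k + 1).val + firstCoeff K θ p (k - 1).val
            - 2 * firstCoeff K θ p k.val))
          - 1 / (N : ℝ) ^ 2 * ((1 + θ) * (secondCoeff K θ p (k + 1).val
            + secondCoeff K θ p (k - 1).val - 2 * secondCoeff K θ p k.val)) := by
        simp only [he]
        ring
      have h0' := eq_sub_of_add_eq h0
      rw [hE1, h1, h2]
      simp only [he]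
      generalize (∫ η, (η.1 0 : ℝ) * η.1 (k + 1) ∂ν) = s₁ at *
      generalize (∫ η, (η.1 0 : ℝ) * η.1 (k - 1) ∂ν) = s₂ at *
      generalize (∫ η, (η.1 0 : ℝ) * η.1 k ∂ν) = s at *
      rw [eq_add_of_sub_eq h0']
      generalize firstCoeff K θ p k.val = c₁
      generalize secondCoeff K θ p k.val = c₂
      generalize ((if k = 1 then 1 else 0) + (if k = -1 then 1 else 0) : ℝ) = d
      split_ifs
      · field_simp
        ring
      · field_simp
        ring
    -- The factor `2` comes from `N ≤ 2 (N - 1)`.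
    rw [hE, abs_mul, abs_neg, show 2 * C * (1 / (N : ℝ) ^ 3) = C * (2 / (N : ℝ) ^ 3) by ring]
    refine mul_le_mul (hC k) ?_ (abs_nonneg _) hC0
    rw [abs_of_pos (by positivity), div_le_div_iff₀ (by positivity)
      (by positivity)]
    nlinarith [mul_nonneg (sq_nonneg (N : ℝ)) (sub_nonneg.mpr hN2)]
  refine (abs_le_of_laplacian_sub hsum (by positivity) (by positivity) hres k).trans (le_of_eq ?_)
  ring

end Expansion

theorem theorem4 (K : ℕ) [NeZero K] (hK : 3 ≤ K) (θ p : ℝ) (hθ : 0 < θ) (hp : 0 < p) :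
    (∀ N : ℕ, 2 ≤ N →
      ∃! ν : MeasureTheory.Measure (Config K N), IsStationaryDistribution θ p ν) ∧
    ∀ ν : (N : ℕ) → MeasureTheory.Measure (Config K N),
      (∀ N : ℕ, 2 ≤ N → IsStationaryDistribution θ p (ν N)) →
      ∀ k : ZMod K,
        (fun N : ℕ =>
          cov[fun η : Config K N => (η.1 0 : ℝ) / (N : ℝ),
              fun η : Config K N => (η.1 k : ℝ) / (N : ℝ); ν N]
            - (1 / (N : ℝ) * firstCoeff K θ p k.val
                + 1 / (N : ℝ) ^ 2 * secondCoeff K θ p k.val))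
          =o[Filter.atTop] (fun N : ℕ => 1 / (N : ℝ) ^ 2) := by
  refine ⟨fun N hN => existsUnique_isStationaryDistribution hN hθ hp, fun ν hν k => ?_⟩
  obtain ⟨C, hC⟩ : ∃ C : ℝ, ∀ k : ZMod K, |(if k = 0 then 2 * p else 0) / K - 2 * p / (K : ℝ) ^ 2
      - 2 * p * firstCoeff K θ p k.val - 2 * p * secondCoeff K θ p k.val| ≤ C :=
    (Finite.exists_max _).imp' _ fun _ => id
  refine (Asymptotics.IsBigO.of_bound (g := fun N : ℕ => 1 / (N : ℝ) ^ 3)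
    (8 * (K : ℝ) ^ 3 * C / (1 + θ))
    ((Filter.eventually_ge_atTop 2).mono fun N hN => ?_)).trans_isLittleO ?_
  · rw [Real.norm_of_nonneg (show (0 : ℝ) ≤ 1 / (N : ℝ) ^ 3 by positivity)]
    exact abs_covariance_sub_le hθ hp hC hN (hν N hN) k
  have h1 : (fun N : ℕ => 1 / (N : ℝ) ^ 3) = fun N : ℕ => 1 / (N : ℝ) * (1 / (N : ℝ) ^ 2) := by
    funext N
    rw [div_mul_div_comm]
    ring
  have h2 : (fun N : ℕ => 1 / (N : ℝ)) =o[Filter.atTop] fun _ : ℕ => (1 : ℝ) :=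
    (Asymptotics.isLittleO_one_iff ℝ).mpr tendsto_one_div_atTop_nhds_zero_nat
  rw [h1]
  simpa only [one_mul] using h2.mul_isBigO (Asymptotics.isBigO_refl (fun N : ℕ => 1 / (N : ℝ) ^ 2) Filter.atTop)
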